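/- **Theorem (Oberschelp–Fujiwara Interpolation).** Work in classical first-order logic with equality (over nonempty structures, with truth constants), where formulas may contain predicate symbols, function symbols (constants being $0$-ary function symbols) and free individual variables; equality $=$ is a logical symbol, not one of the predicate symbols. $F \models G$ means that in every structure, every assignment of the free variables that satisfies $F$ satisfies $G$. An occurrence of an atom in a formula is positive (negative) if it lies in the scope of an even (odd) number of negations, where the antecedent of an implication counts as negated. For a formula $F$ let $\mathrm{Voc}^{\pm}(F)$ be the set consisting of all pairs $+p$ (respectively $-p$) such that the predicate symbol $p$ has a positive (respectively negative) occurrence in $F$, all function symbols (including constants) occurring in $F$, and all free individual variables of $F$. Let $F, G$ be formulas of first-order logic with equality such that $F \models G$. Then there exists a formula $H$ of first-order logic with equality such that 1. $F \models H$ and $H \models G$; 2. $\mathrm{Voc}^{\pm}(H) \subseteq \mathrm{Voc}^{\pm}(F) \cap \mathrm{Voc}^{\pm}(G)$; 3. if $=$ occurs positively in $H$, then $=$ occurs positively in $F$; and if $=$ occurs negatively in $H$, then $=$ occurs negatively in $G$. -/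

import Mathlib

open FirstOrder

universe u v w

namespace FirstOrder.Language

/-- The function symbols (constants being the `0`-ary ones) occurring in a term. -/
def Term.funSyms {L : Language.{u, v}} {β : Type w} : L.Term β → Set (Σ k, L.Functions k)
  | .var _ => ∅
  | .func f ts => {⟨_, f⟩} ∪ ⋃ i, (ts i).funSyms

namespace BoundedFormula

variable {L : Language.{u, v}} {α : Type w}

/-- The function symbols (including constants) occurring in a formula. -/
def funSyms : {n : ℕ} → L.BoundedFormula α n → Set (Σ k, L.Functions k)
  | _, .falsum => ∅
  | _, .equal t₁ t₂ => t₁.funSyms ∪ t₂.funSyms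
  | _, .rel _ ts => ⋃ i, (ts i).funSyms
  | _, .imp φ ψ => φ.funSyms ∪ ψ.funSyms
  | _, .all φ => φ.funSyms

/-- `φ.predSyms s` is the set of the (non-logical) predicate symbols that occur in `φ` in an atom
of polarity `s`, where `true` is positive and `false` is negative. Passing to the antecedent of an
implication (in particular, to the scope of a negation `φ.imp ⊥`) flips the polarity. -/
def predSyms : {n : ℕ} → L.BoundedFormula α n → Bool → Set (Σ k, L.Relations k)
  | _, .falsum, _ => ∅
  | _, .equal _ _, _ => ∅
  | _, .rel R _, s => {p | p = ⟨_, R⟩ ∧ s = true}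
  | _, .imp φ ψ, s => φ.predSyms (!s) ∪ ψ.predSyms s
  | _, .all φ, s => φ.predSyms s

/-- `φ.EqOccurs s` says that the equality symbol occurs in `φ` with polarity `s`, where `true` is
positive and `false` is negative. -/
def EqOccurs : {n : ℕ} → L.BoundedFormula α n → Bool → Prop
  | _, .falsum, _ => False
  | _, .equal _ _, s => s = true
  | _, .rel _ _, _ => False
  | _, .imp φ ψ, s => φ.EqOccurs (!s) ∨ ψ.EqOccurs s
  | _, .all φ, s => φ.EqOccurs s

end BoundedFormula

/-- The items of a polarity-sensitive vocabulary: predicate symbols with a polarity, function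
symbols (including constants), and free individual variables. -/
inductive VocItem (L : Language.{u, v}) (α : Type w) : Type (max u v w)
  | pred (s : Bool) {k : ℕ} (R : L.Relations k) : VocItem L α
  | func {k : ℕ} (f : L.Functions k) : VocItem L α
  | fvar (a : α) : VocItem L α

open Classical in
/-- The polarity-sensitive vocabulary `Voc±(φ)` of a formula. Equality, being a logical symbol, is
not a member; it is tracked by `BoundedFormula.EqOccurs`. -/
def Formula.voc {L : Language.{u, v}} {α : Type w} (φ : L.Formula α) : Set (VocItem L α) :=
  {x | match x with
    | .pred s R => ⟨_, R⟩ ∈ BoundedFormula.predSyms φ s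
    | .func f => ⟨_, f⟩ ∈ BoundedFormula.funSyms φ
    | .fvar a => a ∈ BoundedFormula.freeVarFinset φ}

end FirstOrder.Language

/-!
The proof is model-theoretic. Suppose that `F` and `G` have no interpolant; a model of `F` and `¬ G`
is constructed.

The elements of that model are named by `SkTerm`s, the terms built from all function symbols, the
free variables and Skolem functions for both sides. One looks for a model `A` of `F` and a model `B`
of `¬ G`, together with interpretations `a` and `b` of the terms in `A` and `B`, such that

* `a` respects the free variables, the function symbols of `F` and the Skolem functions of the left
  side, while `b` does the same for `G` and the right side;
* every formula about terms that is written in the signature of the interpolant, and in particular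
  every literal, is preserved from `A` to `B`.

For no constraints but those on the common variables, and for finitely many formulas, such a pair
exists because otherwise a Boolean combination of these formulas would be an interpolant
(`approximable_common`). Terms are added to it one by one, subterms first: the value of a term is
prescribed on at most one of the sides, and the value on the other side is found by preservation of
a quantified formula; if it is prescribed on both, the head symbol is common and the term can be
substituted away (`Approximable.insert`). An ultraproduct over the finite approximations makes all
constraints hold at the same time (`exists_isPair`).

The model is the set `{(a t, b t) | t a term}` of pairs (`IsPair.exists_model`). A predicate holds
there as far as it is forced to by its positive occurrences in `F` and its negative ones in `G`, and
preservation of literals shows that this does not conflict with the occurrences of the other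
polarities. The same is true of equality. Two pairs are equal only if both components are, so
negative occurrences in `F` and positive ones in `G` ask for nothing. A positive occurrence in `F`
asks that equal left components belong to equal pairs, which is preservation of `=`; a negative one
in `G` asks the same of right components, which is preservation of `≠`. Hence just these two kinds
of equality literals are needed in the interpolant. As the Skolem functions provide
counterexamples, the projections to `A` and `B` transfer `F` and `G`
(`BoundedFormula.realize_transfer`).
-/

namespace FirstOrder.Language

open Structure

/-! ### Formulas over a polarity-sensitive signature -/

/-- A polarity-sensitive signature: the predicate symbols admitted in atoms of each polarity, the
admitted function symbols, and the polarities in which equality is admitted. -/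
structure Signature (L : Language.{u, v}) where
  rel : Bool → Set (Σ k, L.Relations k)
  func : Set (Σ k, L.Functions k)
  eq : Bool → Prop

namespace Term

variable {L : Language.{u, v}} {β γ : Type*}

/-- The term is built from function symbols in `D` and variables in `W`. -/
def Over (D : Set (Σ k, L.Functions k)) (W : Set β) : L.Term β → Prop
  | .var x => x ∈ W
  | .func f ts => ⟨_, f⟩ ∈ D ∧ ∀ i, (ts i).Over D W

variable {D : Set (Σ k, L.Functions k)}

theorem Over.subst {W : Set β} {W' : Set γ} {tf : β → L.Term γ}
    (htf : ∀ x ∈ W, (tf x).Over D W') : ∀ {t : L.Term β}, t.Over D W → (t.subst tf).Over D W'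
  | .var _, h => htf _ h
  | .func _ _, h => ⟨h.1, fun i => (h.2 i).subst htf⟩

theorem Over.relabel {W : Set β} {W' : Set γ} {g : β → γ} (hg : ∀ x ∈ W, g x ∈ W') :
    ∀ {t : L.Term β}, t.Over D W → (t.relabel g).Over D W'
  | .var _, h => hg _ h
  | .func _ _, h => ⟨h.1, fun i => (h.2 i).relabel hg⟩

end Term

/-- The variables from `V` among the free ones, together with all the bound ones. -/
def scope {α : Type*} (V : Set α) (n : ℕ) : Set (α ⊕ Fin n) :=
  {x | ∀ a, x = Sum.inl a → a ∈ V}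

@[simp]
theorem inl_mem_scope {α : Type*} {V : Set α} {n : ℕ} {a : α} :
    (Sum.inl a : α ⊕ Fin n) ∈ scope V n ↔ a ∈ V := by
  simp [scope]

@[simp]
theorem inr_mem_scope {α : Type*} {V : Set α} {n : ℕ} {i : Fin n} :
    (Sum.inr i : α ⊕ Fin n) ∈ scope V n := by
  simp [scope]

open Classical in
theorem Term.over_scope_iff {L : Language.{u, v}} {α : Type*} {D : Set (Σ k, L.Functions k)}
    {V : Set α} {n : ℕ} (t : L.Term (α ⊕ Fin n)) :
    t.Over D (scope V n) ↔ t.funSyms ⊆ D ∧ ∀ a ∈ t.varFinsetLeft, a ∈ V := by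
  induction t with
  | var x => rcases x with a | i <;> simp [Term.Over, Term.funSyms, Term.varFinsetLeft]
  | func f ts ih =>
    simp only [Term.Over, ih, Term.funSyms, Term.varFinsetLeft, Set.union_subset_iff,
      Set.singleton_subset_iff, Set.iUnion_subset_iff, Finset.mem_biUnion, Finset.mem_univ,
      true_and, forall_exists_index, forall_and]
    tauto

namespace BoundedFormula

variable {L : Language.{u, v}} {α β : Type*}

/-- `φ.Over σ V s` says that `φ`, placed at a position of polarity `s`, only uses symbols admitted
by `σ` and free variables in `V`. -/
def Over (σ : Signature L) (V : Set α) : {n : ℕ} → L.BoundedFormula α n → Bool → Prop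
  | _, .falsum, _ => True
  | n, .equal t₁ t₂, s => σ.eq s ∧ t₁.Over σ.func (scope V n) ∧ t₂.Over σ.func (scope V n)
  | n, .rel R ts, s => ⟨_, R⟩ ∈ σ.rel s ∧ ∀ i, (ts i).Over σ.func (scope V n)
  | _, .imp φ ψ, s => φ.Over σ V (!s) ∧ ψ.Over σ V s
  | _, .all φ, s => φ.Over σ V s

variable {σ : Signature L} {V : Set α} {V' : Set β}

open Classical in
/-- The inductively defined `Over` unfolded in terms of the symbols that occur in a formula. -/
theorem over_iff {n : ℕ} (φ : L.BoundedFormula α n) (s : Bool) :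
    φ.Over σ V s ↔ (∀ s', φ.predSyms s' ⊆ σ.rel (s == s')) ∧
      (∀ s', φ.EqOccurs s' → σ.eq (s == s')) ∧ φ.funSyms ⊆ σ.func ∧
      ∀ a ∈ φ.freeVarFinset, a ∈ V := by
  induction φ generalizing s with
  | falsum => simp [Over, predSyms, EqOccurs, funSyms, freeVarFinset]
  | equal t₁ t₂ =>
    simp only [Over, predSyms, EqOccurs, funSyms, freeVarFinset, Term.over_scope_iff,
      Set.union_subset_iff, Finset.mem_union, or_imp, forall_and]
    simp
    tauto
  | rel R ts =>
    simp only [Over, predSyms, EqOccurs, funSyms, freeVarFinset, Term.over_scope_iff,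
      Set.iUnion_subset_iff, Finset.mem_biUnion, Finset.mem_univ, true_and,
      forall_exists_index, forall_and]
    simp only [Bool.forall_bool, Set.subset_def, Set.mem_ofPred_eq]
    simp
    tauto
  | imp φ ψ ihφ ihψ =>
    simp only [Over, predSyms, EqOccurs, funSyms, freeVarFinset, ihφ, ihψ, Set.union_subset_iff,
      Finset.mem_union, or_imp, forall_and, Bool.forall_bool]
    cases s <;> simp <;> tauto
  | all φ ih => exact ih s

theorem Over.mono {V₁ V₂ : Set α} (h : V₁ ⊆ V₂) {n : ℕ} {φ : L.BoundedFormula α n} {s : Bool}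
    (hφ : φ.Over σ V₁ s) : φ.Over σ V₂ s := by
  rw [over_iff] at hφ ⊢
  exact ⟨hφ.1, hφ.2.1, hφ.2.2.1, fun a ha => h (hφ.2.2.2 a ha)⟩

open Classical in
theorem Over.freeVarFinset {n : ℕ} {φ : L.BoundedFormula α n} {s : Bool} (hφ : φ.Over σ V s) :
    φ.Over σ {a | a ∈ φ.freeVarFinset} s := by
  rw [over_iff] at hφ ⊢
  exact ⟨hφ.1, hφ.2.1, hφ.2.2.1, fun a ha => ha⟩

theorem Over.castLE {m n : ℕ} (h : m ≤ n) {φ : L.BoundedFormula α m} {s : Bool}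
    (hφ : φ.Over σ V s) : (φ.castLE h).Over σ V s := by
  have key (m n : ℕ) (h : m ≤ n) (x : α ⊕ Fin m) (hx : x ∈ scope V m) :
      Sum.map id (Fin.castLE h) x ∈ scope V n := by
    rcases x with a | i <;> simp_all
  induction φ generalizing n s with
  | falsum => trivial
  | equal t₁ t₂ => exact ⟨hφ.1, hφ.2.1.relabel (key _ _ _), hφ.2.2.relabel (key _ _ _)⟩
  | rel R ts => exact ⟨hφ.1, fun i => (hφ.2 i).relabel (key _ _ _)⟩
  | imp φ ψ ihφ ihψ => exact ⟨ihφ h hφ.1, ihψ h hφ.2⟩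
  | all φ ih => exact ih _ hφ

theorem Over.mapTermRel {g : ℕ → ℕ} {ft : ∀ n, L.Term (α ⊕ Fin n) → L.Term (β ⊕ Fin (g n))}
    {h : ∀ n, L.BoundedFormula β (g (n + 1)) → L.BoundedFormula β (g n + 1)}
    (hft : ∀ n t, t.Over σ.func (scope V n) → (ft n t).Over σ.func (scope V' (g n)))
    (hh : ∀ n φ s, φ.Over σ V' s → (h n φ).Over σ V' s)
    {n : ℕ} {φ : L.BoundedFormula α n} {s : Bool} (hφ : φ.Over σ V s) :
    (φ.mapTermRel ft (fun _ => id) h).Over σ V' s := by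
  induction φ generalizing s with
  | falsum => trivial
  | equal t₁ t₂ => exact ⟨hφ.1, hft _ _ hφ.2.1, hft _ _ hφ.2.2⟩
  | rel R ts => exact ⟨hφ.1, fun i => hft _ _ (hφ.2 i)⟩
  | imp φ ψ ihφ ihψ => exact ⟨ihφ hφ.1, ihψ hφ.2⟩
  | all φ ih => exact hh _ _ _ (ih hφ)

theorem Over.subst {tf : α → L.Term β} (htf : ∀ x ∈ V, (tf x).Over σ.func V') {n : ℕ}
    {φ : L.BoundedFormula α n} {s : Bool} (hφ : φ.Over σ V s) : (φ.subst tf).Over σ V' s := by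
  refine hφ.mapTermRel (g := fun n => n) (ft := fun _ t => t.subst _) (h := fun _ => id)
    (fun n t ht => ht.subst ?_) fun _ _ _ h => h
  rintro (a | i) hx
  · exact (htf a (by simpa using hx)).relabel fun x hx => by simpa using hx
  · exact inr_mem_scope

theorem Over.relabel {m : ℕ} {g : α → β ⊕ Fin m} (hg : ∀ x ∈ V, g x ∈ scope V' m) {n : ℕ}
    {φ : L.BoundedFormula α n} {s : Bool} (hφ : φ.Over σ V s) : (φ.relabel g).Over σ V' s := by
  refine hφ.mapTermRel (fun n t ht => ht.relabel ?_) fun _ _ _ h => h.castLE _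
  rintro (a | i) hx
  · have := hg a (by simpa using hx)
    rcases hga : g a with b | j
    · rw [hga] at this
      simpa [relabelAux, hga] using this
    · simp [relabelAux, hga]
  · simp [relabelAux]

end BoundedFormula

namespace Formula

variable {L : Language.{u, v}} {α β : Type*} {σ : Signature L} {V : Set α} {V' : Set β}

theorem over_foldr_inf {l : List (L.Formula α)} {s : Bool}
    (h : ∀ φ ∈ l, BoundedFormula.Over σ V φ s) :
    BoundedFormula.Over σ V (l.foldr (· ⊓ ·) ⊤) s := by
  induction l with
  | nil => exact ⟨trivial, trivial⟩
  | cons φ l ih =>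
    have h₁ := h φ (by simp)
    have h₂ := ih fun ψ hψ => h ψ (by simp [hψ])
    -- `φ ⊓ ψ` is `¬ (φ → ¬ ψ)`: both conjuncts have their polarity flipped twice.
    refine ⟨⟨?_, ?_, trivial⟩, trivial⟩
    · simpa using h₁
    · simpa using h₂

theorem over_foldr_sup {l : List (L.Formula α)} {s : Bool}
    (h : ∀ φ ∈ l, BoundedFormula.Over σ V φ s) :
    BoundedFormula.Over σ V (l.foldr (· ⊔ ·) ⊥) s := by
  induction l with
  | nil => trivial
  | cons φ l ih =>
    have h₁ := h φ (by simp)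
    have h₂ := ih fun ψ hψ => h ψ (by simp [hψ])
    refine ⟨⟨?_, trivial⟩, h₂⟩
    simpa using h₁

/-- The universal quantification of `φ` over the variables that `g` sends to the right summand, the
others being renamed along `g`. -/
def forallVar (g : α → β ⊕ Fin 1) (φ : L.Formula α) : L.Formula β :=
  BoundedFormula.all (n := 0) (BoundedFormula.relabel g φ)

theorem over_forallVar {g : α → β ⊕ Fin 1} (hg : ∀ x ∈ V, g x ∈ scope V' 1) {φ : L.Formula α}
    {s : Bool} (hφ : BoundedFormula.Over σ V φ s) :
    BoundedFormula.Over σ V' (φ.forallVar g) s :=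
  BoundedFormula.Over.relabel hg hφ

theorem realize_forallVar {M : Type*} [L.Structure M] {g : α → β ⊕ Fin 1} {φ : L.Formula α}
    {v : β → M} :
    (φ.forallVar g).Realize v ↔ ∀ m : M, φ.Realize (Sum.elim v (fun _ => m) ∘ g) := by
  refine forall_congr' fun m => ?_
  refine (BoundedFormula.realize_relabel (m := 1) (n := 0)).trans ?_
  have h : ((Fin.snoc default m : Fin (0 + 1) → M) ∘ Fin.castAdd 0 : Fin 1 → M) = fun _ => m := by
    funext i
    rw [Subsingleton.elim i 0]
    rfl
  rw [Formula.Realize, ← h, iff_eq_eq]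
  exact congrArg _ (Subsingleton.elim _ _)

open Classical in
/-- Universal quantification over the free variable `x`. The type of the variables stays the
same, but `x` no longer occurs free. -/
noncomputable def allAt (x : α) (φ : L.Formula α) : L.Formula α :=
  φ.forallVar fun y => if y = x then Sum.inr 0 else Sum.inl y

open Classical in
theorem realize_allAt {M : Type*} [L.Structure M] {x : α} {φ : L.Formula α} {v : α → M} :
    (φ.allAt x).Realize v ↔ ∀ m : M, φ.Realize (Function.update v x m) := by
  rw [allAt, realize_forallVar]
  refine forall_congr' fun m => ?_
  rw [iff_eq_eq]
  congr 1
  funext y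
  by_cases h : y = x <;> simp [h]

theorem over_allAt {x : α} {φ : L.Formula α} {s : Bool}
    (hφ : BoundedFormula.Over σ (insert x V) φ s) : BoundedFormula.Over σ V (φ.allAt x) s := by
  refine over_forallVar (fun y hy => ?_) hφ
  by_cases h : y = x
  · simp [h]
  · simpa [h] using hy

/-- Existential quantification over the free variable `x`. -/
noncomputable def exAt (x : α) (φ : L.Formula α) : L.Formula α :=
  (φ.not.allAt x).not

open Classical in
theorem realize_exAt {M : Type*} [L.Structure M] {x : α} {φ : L.Formula α} {v : α → M} :
    (φ.exAt x).Realize v ↔ ∃ m : M, φ.Realize (Function.update v x m) := by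
  rw [exAt, realize_not, realize_allAt]
  simp only [realize_not, not_forall, not_not]

theorem over_exAt {x : α} {φ : L.Formula α} {s : Bool}
    (hφ : BoundedFormula.Over σ (insert x V) φ s) : BoundedFormula.Over σ V (φ.exAt x) s := by
  refine ⟨over_allAt ⟨?_, trivial⟩, trivial⟩
  simpa using hφ

end Formula

/-! ### Skolem terms -/

/-- Terms that name the elements of both structures of the construction: besides the free variables
and the function symbols, there is for each formula `φ` and each of the two sides (told apart by the
Boolean tag) a symbol for a Skolem function yielding a counterexample to `∀ x, φ`. -/
inductive SkTerm (L : Language.{u, v}) (α : Type w) : Type (max u v w)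
  | var (a : α) : SkTerm L α
  | func {k : ℕ} (f : L.Functions k) (ts : Fin k → SkTerm L α) : SkTerm L α
  | sk (s : Bool) {k : ℕ} (φ : L.BoundedFormula α (k + 1)) (ts : Fin k → SkTerm L α) : SkTerm L α

/-- A nonempty structure with an assignment of the free variables. -/
structure Interp (L : Language.{u, v}) (α : Type w) where
  carrier : Type (max u v w)
  [str : L.Structure carrier]
  [nonempty : Nonempty carrier]
  val : α → carrier

attribute [instance] Interp.str Interp.nonempty

variable {L : Language.{u, v}} {α : Type w}

namespace SkTerm

/-- The immediate subterms. -/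
def args : SkTerm L α → Set (SkTerm L α)
  | var _ => ∅
  | func _ ts => Set.range ts
  | sk _ _ ts => Set.range ts

/-- The head symbol of the term has a prescribed meaning on side `s`, whose formula has function
symbols `D` and free variables `W`. -/
def Owned (D : Set (Σ k, L.Functions k)) (W : Set α) (s : Bool) : SkTerm L α → Prop
  | var a => a ∈ W
  | func f _ => ⟨_, f⟩ ∈ D
  | sk s' _ _ => s' = s

end SkTerm

namespace Interp

/-- `m` is an admissible value of `t` when the immediate subterms of `t` are evaluated by `a`. -/
def Fits (A : Interp L α) (a : SkTerm L α → A.carrier) : SkTerm L α → A.carrier → Prop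
  | .var x, m => m = A.val x
  | .func f ts, m => m = funMap f fun i => a (ts i)
  | .sk _ φ ts, m => φ.Realize A.val (Fin.snoc (fun i => a (ts i)) m) →
      φ.all.Realize A.val fun i => a (ts i)

theorem fits_congr {A : Interp L α} {a a' : SkTerm L α → A.carrier} {t : SkTerm L α}
    {m : A.carrier} (h : ∀ u ∈ t.args, a u = a' u) : A.Fits a t m ↔ A.Fits a' t m := by
  cases t with
  | var x => rfl
  | func f ts =>
    have : (fun i => a (ts i)) = fun i => a' (ts i) := funext fun i => h _ ⟨i, rfl⟩
    simp only [Fits, this]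
  | sk s φ ts =>
    have : (fun i => a (ts i)) = fun i => a' (ts i) := funext fun i => h _ ⟨i, rfl⟩
    simp only [Fits, this]

theorem exists_fits (A : Interp L α) (a : SkTerm L α → A.carrier) (t : SkTerm L α) :
    ∃ m, A.Fits a t m := by
  cases t with
  | var x => exact ⟨_, rfl⟩
  | func f ts => exact ⟨_, rfl⟩
  | sk s φ ts =>
    by_cases h : φ.all.Realize A.val fun i => a (ts i)
    · exact ⟨Classical.arbitrary _, fun _ => h⟩
    · obtain ⟨m, hm⟩ := not_forall.1 h
      exact ⟨m, fun h' => (hm h').elim⟩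

/-- `a` gives admissible values to those terms in `V` whose head symbol has a prescribed meaning. -/
def Respects (A : Interp L α) (a : SkTerm L α → A.carrier) (D : Set (Σ k, L.Functions k))
    (W : Set α) (s : Bool) (V : Set (SkTerm L α)) : Prop :=
  ∀ t ∈ V, t.Owned D W s → A.Fits a t (a t)

open Classical in
theorem Respects.insert {A : Interp L α} {a : SkTerm L α → A.carrier}
    {D : Set (Σ k, L.Functions k)} {W : Set α} {s : Bool} {V : Set (SkTerm L α)}
    (h : A.Respects a D W s V) (hV : ∀ u ∈ V, u.args ⊆ V) {t : SkTerm L α} (ht : t.args ⊆ V)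
    (htV : t ∉ V) {m : A.carrier} (hm : t.Owned D W s → A.Fits a t m) :
    A.Respects (Function.update a t m) D W s (insert t V) := by
  have key (u : SkTerm L α) (hu : u.args ⊆ V) (m' : A.carrier) :
      A.Fits (Function.update a t m) u m' ↔ A.Fits a u m' :=
    fits_congr fun x hx => Function.update_of_ne (fun hxt : x = t => htV (hxt ▸ hu hx)) _ _
  rintro u (rfl | hu) hD
  · rw [key _ ht, Function.update_self]
    exact hm hD
  · rw [key _ (hV u hu), Function.update_of_ne (fun hut : u = t => htV (hut ▸ hu))]
    exact h u hu hD

end Interp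

/-! ### Approximating the pair of structures -/

open Classical in
/-- The free variables of a formula. -/
def Formula.freeVars (φ : L.Formula α) : Set α :=
  {a | a ∈ BoundedFormula.freeVarFinset φ}

/-- The signature in which an interpolant of `F` and `G` has to be written. -/
def interpolantSignature (F G : L.Formula α) : Signature L where
  rel s := F.predSyms s ∩ G.predSyms s
  func := F.funSyms ∩ G.funSyms
  eq
    | true => F.EqOccurs true
    | false => G.EqOccurs false

/-- An interpolant, with the conditions on its symbols expressed by a signature. -/
def IsInterpolant (F G H : L.Formula α) : Prop :=
  BoundedFormula.Over (interpolantSignature F G) (F.freeVars ∩ G.freeVars) H true ∧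
    (∀ A : Interp L α, F.Realize A.val → H.Realize A.val) ∧
    ∀ A : Interp L α, H.Realize A.val → G.Realize A.val

/-- `a` and `b` interpret the terms in a model of `F` and a model of `¬ G`, respectively, with
admissible values on `V`, and the formulas in `Φ` are preserved from left to right. -/
structure IsPair (F G : L.Formula α) (V : Set (SkTerm L α)) (Φ : Set (L.Formula (SkTerm L α)))
    (A B : Interp L α) (a : SkTerm L α → A.carrier) (b : SkTerm L α → B.carrier) : Prop where
  left : F.Realize A.val
  right : ¬ G.Realize B.val
  respects_left : A.Respects a F.funSyms F.freeVars true V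
  respects_right : B.Respects b G.funSyms G.freeVars false V
  preserves : ∀ φ ∈ Φ, φ.Realize a → φ.Realize b

/-- Each finite set of formulas of the interpolant signature about terms in `V` can be preserved. -/
def Approximable (F G : L.Formula α) (V : Set (SkTerm L α)) : Prop :=
  ∀ Φ : List (L.Formula (SkTerm L α)),
    (∀ φ ∈ Φ, BoundedFormula.Over (interpolantSignature F G) V φ true) →
    ∃ (A B : Interp L α) (a : SkTerm L α → A.carrier) (b : SkTerm L α → B.carrier),
      IsPair F G V {φ | φ ∈ Φ} A B a b

variable {F G : L.Formula α}

open Classical in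
/-- If there is no interpolant, then formulas in the common free variables can be preserved.
Otherwise, the disjunction over all models of `F` of the conjunction of those formulas in `Φ` that
hold there would be an interpolant. -/
theorem approximable_common (hFG : ∀ H, ¬ IsInterpolant F G H) :
    Approximable F G (SkTerm.var '' (F.freeVars ∩ G.freeVars)) := by
  intro Φ hΦ
  -- The terms other than variables do not occur in `Φ`. They are all sent to a single dummy
  -- variable, over which the interpolant quantifies, since `α` may be empty.
  let g : SkTerm L α → α ⊕ Fin 1
    | .var x => Sum.inl x
    | _ => Sum.inr 0
  let ext (A : Interp L α) (m : A.carrier) : SkTerm L α → A.carrier :=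
    Sum.elim A.val (fun _ => m) ∘ g
  let type (A : Interp L α) (m : A.carrier) : List (L.Formula (SkTerm L α)) :=
    Φ.filter fun φ => φ.Realize (ext A m)
  let types := Φ.sublists.filter fun l =>
    ∃ (A : Interp L α) (m : A.carrier), F.Realize A.val ∧ l = type A m
  let H' : L.Formula (SkTerm L α) := (types.map fun l => l.foldr (· ⊓ ·) ⊤).foldr (· ⊔ ·) ⊥
  have hH' {M : Type (max u v w)} [L.Structure M] (a : SkTerm L α → M) :
      H'.Realize a ↔ ∃ l ∈ types, ∀ φ ∈ l, φ.Realize a := by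
    simp only [H', Formula.Realize, BoundedFormula.realize_foldr_sup, List.mem_map,
      exists_exists_and_eq_and, BoundedFormula.realize_foldr_inf]
  have hover : BoundedFormula.Over (interpolantSignature F G) (F.freeVars ∩ G.freeVars)
      (H'.forallVar g) true := by
    refine Formula.over_forallVar (V := SkTerm.var '' (F.freeVars ∩ G.freeVars)) ?_
      (Formula.over_foldr_sup ?_)
    · rintro _ ⟨x, hx, rfl⟩
      simpa [g] using hx
    · intro φ hφ
      obtain ⟨l, hl, rfl⟩ := List.mem_map.1 hφ
      refine Formula.over_foldr_inf fun φ hφ => hΦ φ ?_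
      exact (List.mem_sublists.1 (List.mem_filter.1 hl).1).subset hφ
  have hF (A : Interp L α) (hA : F.Realize A.val) : (H'.forallVar g).Realize A.val := by
    rw [Formula.realize_forallVar]
    intro m
    refine (hH' _).2 ⟨type A m, List.mem_filter.2 ⟨List.mem_sublists.2 List.filter_sublist, ?_⟩, ?_⟩
    · exact decide_eq_true ⟨A, m, hA, rfl⟩
    · intro φ hφ
      simpa using (List.mem_filter.1 hφ).2
  obtain ⟨B, hB, hBG⟩ : ∃ B : Interp L α, (H'.forallVar g).Realize B.val ∧ ¬ G.Realize B.val := by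
    by_contra! h
    exact hFG _ ⟨hover, hF, h⟩
  let n : B.carrier := Classical.arbitrary _
  obtain ⟨l, hl, hlB⟩ := (hH' _).1 (Formula.realize_forallVar.1 hB n)
  obtain ⟨A, m, hA, rfl⟩ : ∃ (A : Interp L α) (m : A.carrier), F.Realize A.val ∧ l = type A m := by
    simpa using (List.mem_filter.1 hl).2
  refine ⟨A, B, ext A m, ext B n, hA, hBG, ?_, ?_, fun φ hφ h => hlB φ ?_⟩
  · rintro _ ⟨x, hx, rfl⟩ -
    rfl
  · rintro _ ⟨x, hx, rfl⟩ -
    rfl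
  · exact List.mem_filter.2 ⟨hφ, by simpa using h⟩

open Classical in
/-- Approximability extends to one more term `t`. A value of `t` prescribed on both sides is given
by a common function symbol, so that `t` can be substituted away. If it is prescribed at most on
the left, then a value on the right exists because formulas `∃ t, ⋀ Φ₀` are preserved; if it is
prescribed on the right, then a value on the left exists because formulas `∀ t, ⋁ Φ₀` are. -/
theorem Approximable.insert {V : Set (SkTerm L α)} (h : Approximable F G V)
    (hV : ∀ u ∈ V, u.args ⊆ V) (hcommon : SkTerm.var '' (F.freeVars ∩ G.freeVars) ⊆ V)
    {t : SkTerm L α} (ht : t.args ⊆ V) (htV : t ∉ V) : Approximable F G (insert t V) := by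
  intro Φ hΦ
  by_cases hr : t.Owned G.funSyms G.freeVars false
  · by_cases hl : t.Owned F.funSyms F.freeVars true
    · cases t with
      | var x => exact (htV (hcommon ⟨x, ⟨hl, hr⟩, rfl⟩)).elim
      | sk s φ ts => exact (Bool.noConfusion (hl.symm.trans hr) : False).elim
      | @func k f ts =>
        let tf (x : SkTerm L α) : L.Term (SkTerm L α) :=
          if x = .func f ts then .func f fun i => .var (ts i) else .var x
        have htf (x) (hx : x ∈ Insert.insert (SkTerm.func f ts) V) :
            (tf x).Over (interpolantSignature F G).func V := by
          by_cases hxt : x = .func f ts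
          · simp only [tf, hxt, if_true]
            exact ⟨⟨hl, hr⟩, fun i => ht ⟨i, rfl⟩⟩
          · simp only [tf, hxt, if_false]
            exact hx.resolve_left hxt
        obtain ⟨A, B, a, b, hp⟩ := h (Φ.map fun φ => BoundedFormula.subst φ tf) fun ψ hψ => by
          obtain ⟨φ, hφ, rfl⟩ := List.mem_map.1 hψ
          exact (hΦ φ hφ).subst htf
        have hsubst (C : Interp L α) (c : SkTerm L α → C.carrier) (φ : L.Formula (SkTerm L α)) :
            Formula.Realize (BoundedFormula.subst φ tf) c ↔
              φ.Realize (Function.update c (.func f ts) (funMap f fun i => c (ts i))) := by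
          rw [Formula.Realize, BoundedFormula.realize_subst, Formula.Realize, iff_eq_eq]
          congr 1
          funext x
          by_cases hxt : x = .func f ts
          · subst hxt
            simp [tf]
          · simp [tf, hxt]
        refine ⟨A, B, _, _, hp.left, hp.right, hp.respects_left.insert hV ht htV fun _ => rfl,
          hp.respects_right.insert hV ht htV fun _ => rfl, fun φ hφ hφA => ?_⟩
        exact (hsubst B b φ).1 (hp.preserves _ (List.mem_map.2 ⟨φ, hφ, rfl⟩)
          ((hsubst A a φ).2 hφA))
    · obtain ⟨A, B, a, b, hp⟩ :=
        h (Φ.sublists.map fun l => (l.foldr (· ⊔ ·) ⊥ : L.Formula _).allAt t) fun ψ hψ => by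
          obtain ⟨l, hl, rfl⟩ := List.mem_map.1 hψ
          exact Formula.over_allAt (Formula.over_foldr_sup fun φ hφ =>
            hΦ φ ((List.mem_sublists.1 hl).subset hφ))
      obtain ⟨n, hn⟩ := B.exists_fits b t
      -- If no value of `t` on the left falsified all of `l`, then `∀ t, ⋁ l` would be preserved,
      -- while `n` is a counterexample to it on the right.
      let l := Φ.filter fun φ => ¬ φ.Realize (Function.update b t n)
      obtain ⟨m, hm⟩ : ∃ m, ∀ φ ∈ l, ¬ φ.Realize (Function.update a t m) := by
        by_contra! hcon
        have := hp.preserves _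
          (List.mem_map.2 ⟨l, List.mem_sublists.2 List.filter_sublist, rfl⟩)
          (Formula.realize_allAt.2 fun m =>
            (BoundedFormula.realize_foldr_sup l _ _).2 (hcon m))
        obtain ⟨φ, hφ, hφB⟩ :=
          (BoundedFormula.realize_foldr_sup l _ _).1 (Formula.realize_allAt.1 this n)
        have := (List.mem_filter.1 hφ).2
        simp only [decide_eq_true_eq] at this
        exact this hφB
      refine ⟨A, B, _, _, hp.left, hp.right,
        hp.respects_left.insert hV ht htV (m := m) fun h => (hl h).elim,
        hp.respects_right.insert hV ht htV fun _ => hn, fun φ hφ hφA => ?_⟩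
      by_contra hφB
      exact hm φ (List.mem_filter.2 ⟨hφ, by simpa using hφB⟩) hφA
  · obtain ⟨A, B, a, b, hp⟩ :=
      h (Φ.sublists.map fun l => (l.foldr (· ⊓ ·) ⊤ : L.Formula _).exAt t) fun ψ hψ => by
        obtain ⟨l, hl, rfl⟩ := List.mem_map.1 hψ
        exact Formula.over_exAt (Formula.over_foldr_inf fun φ hφ =>
          hΦ φ ((List.mem_sublists.1 hl).subset hφ))
    obtain ⟨m, hm⟩ := A.exists_fits a t
    let l := Φ.filter fun φ => φ.Realize (Function.update a t m)
    have := hp.preserves _ (List.mem_map.2 ⟨l, List.mem_sublists.2 List.filter_sublist, rfl⟩)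
      (Formula.realize_exAt.2 ⟨m, (BoundedFormula.realize_foldr_inf l _ _).2 fun φ hφ =>
        of_decide_eq_true (List.mem_filter.1 hφ).2⟩)
    obtain ⟨n, hn⟩ := Formula.realize_exAt.1 this
    refine ⟨A, B, _, _, hp.left, hp.right, hp.respects_left.insert hV ht htV fun _ => hm,
      hp.respects_right.insert hV ht htV (m := n) fun h => (hr h).elim, fun φ hφ hφA => ?_⟩
    exact (BoundedFormula.realize_foldr_inf l _ _).1 hn φ
      (List.mem_filter.2 ⟨hφ, by simpa using hφA⟩)

/-- The sets of terms to which the extension step applies. -/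
structure Extendable (F G : L.Formula α) (V : Set (SkTerm L α)) : Prop where
  approximable : Approximable F G V
  args_subset : ∀ u ∈ V, u.args ⊆ V
  common_subset : SkTerm.var '' (F.freeVars ∩ G.freeVars) ⊆ V

theorem Extendable.exists_superset_finset {ι : Type*} {ts : ι → SkTerm L α}
    (hts : ∀ (i : ι) (V : Set (SkTerm L α)), Extendable F G V →
      ∃ V', Extendable F G V' ∧ V ⊆ V' ∧ ts i ∈ V')
    (I : Finset ι) {V : Set (SkTerm L α)} (hV : Extendable F G V) :
    ∃ V', Extendable F G V' ∧ V ⊆ V' ∧ ∀ i ∈ I, ts i ∈ V' := by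
  classical
  induction I using Finset.induction_on with
  | empty => exact ⟨V, hV, subset_rfl, by simp⟩
  | insert i I _ ih =>
    obtain ⟨V₁, h₁, hVV₁, hI⟩ := ih
    obtain ⟨V₂, h₂, hV₁₂, hi⟩ := hts i V₁ h₁
    refine ⟨V₂, h₂, hVV₁.trans hV₁₂, fun j hj => ?_⟩
    rcases Finset.mem_insert.1 hj with rfl | hj
    exacts [hi, hV₁₂ (hI j hj)]

theorem Extendable.exists_superset_of_args {V V' : Set (SkTerm L α)} (hV' : Extendable F G V')
    (hVV' : V ⊆ V') {t : SkTerm L α} (ht : t.args ⊆ V') :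
    ∃ V', Extendable F G V' ∧ V ⊆ V' ∧ t ∈ V' := by
  by_cases htV : t ∈ V'
  · exact ⟨V', hV', hVV', htV⟩
  have hins : V' ⊆ insert t V' := Set.subset_insert _ _
  refine ⟨insert t V', ⟨hV'.approximable.insert hV'.args_subset hV'.common_subset ht htV, ?_,
    hV'.common_subset.trans hins⟩, hVV'.trans hins, Set.mem_insert _ _⟩
  rintro u (rfl | hu)
  exacts [ht.trans hins, (hV'.args_subset u hu).trans hins]

theorem Extendable.exists_superset (t : SkTerm L α) :
    ∀ V : Set (SkTerm L α), Extendable F G V →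
      ∃ V', Extendable F G V' ∧ V ⊆ V' ∧ t ∈ V' := by
  induction t with
  | var x => exact fun V hV => hV.exists_superset_of_args subset_rfl (Set.empty_subset _)
  | func f ts ih =>
    intro V hV
    obtain ⟨V', hV', hVV', hts⟩ := Extendable.exists_superset_finset ih Finset.univ hV
    refine hV'.exists_superset_of_args hVV' ?_
    rintro _ ⟨i, rfl⟩
    exact hts i (Finset.mem_univ i)
  | sk s φ ts ih =>
    intro V hV
    obtain ⟨V', hV', hVV', hts⟩ := Extendable.exists_superset_finset ih Finset.univ hV
    refine hV'.exists_superset_of_args hVV' ?_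
    rintro _ ⟨i, rfl⟩
    exact hts i (Finset.mem_univ i)

theorem exists_isPair_finset (hFG : ∀ H, ¬ IsInterpolant F G H)
    (Φ : Finset (L.Formula (SkTerm L α))) (T : Finset (SkTerm L α)) :
    ∃ (A B : Interp L α) (a : SkTerm L α → A.carrier) (b : SkTerm L α → B.carrier),
      IsPair F G T {φ | φ ∈ Φ ∧
        BoundedFormula.Over (interpolantSignature F G) Set.univ φ true} A B a b := by
  classical
  have hbase : Extendable F G (SkTerm.var '' (F.freeVars ∩ G.freeVars)) :=
    ⟨approximable_common hFG, by rintro _ ⟨x, -, rfl⟩; exact Set.empty_subset _, subset_rfl⟩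
  obtain ⟨V, hV, -, hsub⟩ := Extendable.exists_superset_finset (ts := id)
    (fun t => Extendable.exists_superset t)
    (T ∪ Φ.biUnion fun φ => BoundedFormula.freeVarFinset φ) hbase
  obtain ⟨A, B, a, b, hp⟩ := hV.approximable
    (Φ.toList.filter fun φ => BoundedFormula.Over (interpolantSignature F G) Set.univ φ true) (by
      intro φ hφ
      simp only [List.mem_filter, Finset.mem_toList, decide_eq_true_eq] at hφ
      refine hφ.2.freeVarFinset.mono fun x hx => hsub x ?_
      simp only [Set.mem_ofPred_eq] at hx
      exact Finset.mem_union_right _ (Finset.mem_biUnion.2 ⟨φ, hφ.1, by convert hx⟩))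
  have hT (t : SkTerm L α) (ht : t ∈ (T : Set (SkTerm L α))) : t ∈ V :=
    hsub t (Finset.mem_union_left _ ht)
  exact ⟨A, B, a, b, hp.left, hp.right, fun t ht => hp.respects_left t (hT t ht),
    fun t ht => hp.respects_right t (hT t ht), fun φ hφ => hp.preserves φ (by simpa using hφ)⟩

/-! ### The ultraproduct of the approximations -/

namespace Interp

variable {J : Type (max u v w)} (U : Ultrafilter J) (A : J → Interp L α)

/-- The ultraproduct of structures with assignments. -/
def ultraproduct : Interp L α where
  carrier := (U : Filter J).Product fun j => (A j).carrier
  val x := ((fun j => (A j).val x : ∀ j, (A j).carrier) :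
    (U : Filter J).Product fun j => (A j).carrier)

variable {U A}

/-- The element of the ultraproduct represented by a family of elements. -/
def toUltraproduct (m : ∀ j, (A j).carrier) : (ultraproduct U A).carrier :=
  (m : (U : Filter J).Product fun j => (A j).carrier)

theorem realize_toUltraproduct {β : Type*} {n : ℕ} (φ : L.BoundedFormula β n)
    (x : β → ∀ j, (A j).carrier) (y : Fin n → ∀ j, (A j).carrier) :
    φ.Realize (fun i => toUltraproduct (U := U) (x i)) (fun i => toUltraproduct (y i)) ↔
      ∀ᶠ j in U, φ.Realize (fun i => x i j) fun i => y i j :=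
  Ultraproduct.boundedFormula_realize_cast φ x y

theorem formula_realize_toUltraproduct {β : Type*} (φ : L.Formula β)
    (x : β → ∀ j, (A j).carrier) :
    φ.Realize (fun i => toUltraproduct (U := U) (x i)) ↔ ∀ᶠ j in U, φ.Realize fun i => x i j :=
  Ultraproduct.realize_formula_cast φ x

theorem fits_toUltraproduct {a : ∀ j, SkTerm L α → (A j).carrier} {t : SkTerm L α}
    (h : ∀ᶠ j in U, (A j).Fits (a j) t (a j t)) :
    (ultraproduct U A).Fits (fun t => toUltraproduct fun j => a j t) t
      (toUltraproduct fun j => a j t) := by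
  cases t with
  | var x => exact Quotient.sound h
  | func f ts =>
    refine Eq.trans ?_ (Ultraproduct.funMap_cast (M := fun j => (A j).carrier) (u := U) f
      fun i j => a j (ts i)).symm
    exact Quotient.sound h
  | sk s φ ts =>
    intro h'
    refine (realize_toUltraproduct φ.all (fun x j => (A j).val x) fun i j => a j (ts i)).2 ?_
    have hsnoc {γ : Type (max u v w)} (p : (∀ j, (A j).carrier) → γ) :
        (Fin.snoc (fun i => p fun j => a j (ts i)) (p fun j => a j (.sk s φ ts)) : Fin _ → γ) =
          fun i => p ((Fin.snoc (fun i j => a j (ts i)) fun j => a j (.sk s φ ts) :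
            Fin _ → ∀ j, (A j).carrier) i) :=
      (Fin.comp_snoc (α := ∀ j, (A j).carrier) p _ _).symm
    have h'' := (realize_toUltraproduct φ (fun x j => (A j).val x) _).1
      ((hsnoc (toUltraproduct (U := U))) ▸ h')
    filter_upwards [h, h''] with j hj hj'
    refine hj ?_
    convert hj' using 1
    exact (Fin.comp_snoc (fun p : ∀ j, (A j).carrier => p j) (fun i j => a j (ts i))
      fun j => a j (.sk s φ ts)).symm

end Interp

/-- If there is no interpolant, then all formulas of the interpolant signature can be preserved at
the same time. -/
theorem exists_isPair (hFG : ∀ H, ¬ IsInterpolant F G H) :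
    ∃ (A B : Interp L α) (a : SkTerm L α → A.carrier) (b : SkTerm L α → B.carrier),
      IsPair F G Set.univ
        {φ | BoundedFormula.Over (interpolantSignature F G) Set.univ φ true} A B a b := by
  classical
  choose A B a b hp using fun j : Finset (L.Formula (SkTerm L α)) × Finset (SkTerm L α) =>
    exists_isPair_finset hFG j.1 j.2
  let U : Ultrafilter (Finset (L.Formula (SkTerm L α)) × Finset (SkTerm L α)) :=
    Ultrafilter.of Filter.atTop
  have hU (j₀ : Finset (L.Formula (SkTerm L α)) × Finset (SkTerm L α)) : ∀ᶠ j in U, j₀ ≤ j :=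
    Ultrafilter.of_le _ (Filter.eventually_ge_atTop j₀)
  have ht (t : SkTerm L α) : ∀ᶠ j : Finset (L.Formula (SkTerm L α)) × Finset (SkTerm L α) in U,
      t ∈ (j.2 : Set (SkTerm L α)) :=
    by filter_upwards [hU (∅, {t})] with j hj using hj.2 (Finset.mem_singleton_self t)
  refine ⟨.ultraproduct U A, .ultraproduct U B, fun t => Interp.toUltraproduct fun j => a j t,
    fun t => Interp.toUltraproduct fun j => b j t, ?_, ?_, ?_, ?_, ?_⟩
  · exact (Interp.formula_realize_toUltraproduct F fun x j => (A j).val x).2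
      (.of_forall fun j => (hp j).left)
  · intro h
    obtain ⟨j, hj⟩ :=
      ((Interp.formula_realize_toUltraproduct G fun x j => (B j).val x).1 h).exists
    exact (hp j).right hj
  · intro t _ hD
    exact Interp.fits_toUltraproduct ((ht t).mono fun j hj => (hp j).respects_left t hj hD)
  · intro t _ hD
    exact Interp.fits_toUltraproduct ((ht t).mono fun j hj => (hp j).respects_right t hj hD)
  · intro φ hφ h
    refine (Interp.formula_realize_toUltraproduct φ fun t j => b j t).2 ?_
    filter_upwards [(Interp.formula_realize_toUltraproduct φ fun t j => a j t).1 h,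
      hU ({φ}, ∅)] with j hj hj'
    exact (hp j).preserves φ ⟨hj'.1 (Finset.mem_singleton_self φ), hφ⟩ hj

/-! ### Transfer of formulas along a map -/

section Transfer

variable {K M : Type*} [L.Structure K] [L.Structure M] {σ : Signature L} {V : Set α} {e : K → M}
  {v : α → K} {w : α → M}

theorem Term.realize_transfer
    (hfun : ∀ {k} (f : L.Functions k), ⟨_, f⟩ ∈ σ.func →
      ∀ xs : Fin k → K, e (funMap f xs) = funMap f (e ∘ xs))
    (hvar : ∀ x ∈ V, e (v x) = w x) {n : ℕ} {t : L.Term (α ⊕ Fin n)}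
    (ht : t.Over σ.func (scope V n)) (xs : Fin n → K) :
    t.realize (Sum.elim w (e ∘ xs)) = e (t.realize (Sum.elim v xs)) := by
  induction t with
  | var x =>
    rcases x with a | i
    · exact (hvar a (by simpa [Term.Over] using ht)).symm
    · rfl
  | func f ts ih =>
    simp only [Term.realize, ih _ (ht.2 _), hfun f ht.1]
    rfl

/-- Let `e` be a homomorphism as far as the symbols of `σ` are concerned, and let its image contain
counterexamples to all universal formulas that fail in `M` at arguments from the image. Then `e`
reflects the formulas of `σ`, and preserves those of the opposite polarity. -/
theorem BoundedFormula.realize_transfer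
    (hfun : ∀ {k} (f : L.Functions k), ⟨_, f⟩ ∈ σ.func →
      ∀ xs : Fin k → K, e (funMap f xs) = funMap f (e ∘ xs))
    (hvar : ∀ x ∈ V, e (v x) = w x)
    (hrel_true : ∀ {k} (R : L.Relations k), ⟨_, R⟩ ∈ σ.rel true →
      ∀ xs : Fin k → K, RelMap R (e ∘ xs) → RelMap R xs)
    (hrel_false : ∀ {k} (R : L.Relations k), ⟨_, R⟩ ∈ σ.rel false →
      ∀ xs : Fin k → K, RelMap R xs → RelMap R (e ∘ xs))
    (heq : σ.eq true → Function.Injective e)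
    (hsk : ∀ {k} (φ : L.BoundedFormula α (k + 1)) (xs : Fin k → K), ∃ y,
      φ.Realize w (Fin.snoc (e ∘ xs) (e y)) → φ.all.Realize w (e ∘ xs))
    {n : ℕ} (φ : L.BoundedFormula α n) (xs : Fin n → K) :
    (φ.Over σ V true → φ.Realize w (e ∘ xs) → φ.Realize v xs) ∧
      (φ.Over σ V false → φ.Realize v xs → φ.Realize w (e ∘ xs)) := by
  induction φ with
  | falsum => exact ⟨fun _ h => h, fun _ h => h⟩
  | equal t₁ t₂ =>
    refine ⟨fun ⟨h, h₁, h₂⟩ ht => ?_, fun ⟨_, h₁, h₂⟩ ht => ?_⟩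
    · simp only [Realize, Term.realize_transfer hfun hvar h₁,
        Term.realize_transfer hfun hvar h₂] at ht
      exact heq h ht
    · simp only [Realize, Term.realize_transfer hfun hvar h₁,
        Term.realize_transfer hfun hvar h₂]
      exact congrArg e ht
  | rel R ts =>
    refine ⟨fun ⟨h, hts⟩ ht => ?_, fun ⟨h, hts⟩ ht => ?_⟩
    · simp only [Realize, fun i => Term.realize_transfer hfun hvar (hts i)] at ht
      exact hrel_true R h _ ht
    · simp only [Realize, fun i => Term.realize_transfer hfun hvar (hts i)]
      exact hrel_false R h _ ht
  | imp φ ψ ihφ ihψ =>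
    exact ⟨fun h hM hK => (ihψ xs).1 h.2 (hM ((ihφ xs).2 h.1 hK)),
      fun h hK hM => (ihψ xs).2 h.2 (hK ((ihφ xs).1 h.1 hM))⟩
  | all φ ih =>
    refine ⟨fun h hM y => (ih _).1 h ?_, fun h hK => ?_⟩
    · rw [Fin.comp_snoc]
      exact hM (e y)
    · obtain ⟨y, hy⟩ := hsk φ xs
      refine hy ?_
      rw [← Fin.comp_snoc]
      exact (ih _).2 h (hK y)

end Transfer

/-! ### The amalgam -/

namespace Amalgam

variable {A B : Type (max u v w)}

/-- The common model of `F` and `¬ G`: the pairs of elements of the two structures that are named by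
the same term. -/
def Carrier (a : SkTerm L α → A) (b : SkTerm L α → B) : Type (max u v w) :=
  Set.range fun t => (a t, b t)

variable {a : SkTerm L α → A} {b : SkTerm L α → B}

/-- The pair named by a term. -/
def ofTerm (t : SkTerm L α) : Carrier a b := ⟨(a t, b t), t, rfl⟩

/-- The left component of a pair. -/
def fst (x : Carrier a b) : A := x.1.1

/-- The right component of a pair. -/
def snd (x : Carrier a b) : B := x.1.2

@[ext]
theorem ext {x y : Carrier a b} (h₁ : fst x = fst y) (h₂ : snd x = snd y) : x = y :=
  Subtype.ext (Prod.ext h₁ h₂)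

/-- A term that names a given pair. -/
noncomputable def name (x : Carrier a b) : SkTerm L α := x.2.choose

theorem left_name (x : Carrier a b) : a (name x) = fst x :=
  congrArg Prod.fst x.2.choose_spec

theorem right_name (x : Carrier a b) : b (name x) = snd x :=
  congrArg Prod.snd x.2.choose_spec

/-- Function symbols act on the names of pairs. A relation holds just as far as it is forced to: by
the left structure if it occurs positively in `F`, by the right one if it occurs negatively in
`G`. -/
@[reducible]
noncomputable def inducedStructure [L.Structure A] [L.Structure B] (F G : L.Formula α)
    (a : SkTerm L α → A) (b : SkTerm L α → B) :
    L.Structure (Carrier a b) where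
  funMap f xs := ofTerm (.func f fun i => name (xs i))
  RelMap R xs := (⟨_, R⟩ ∈ F.predSyms true ∧ RelMap R (fst ∘ xs)) ∨
    (⟨_, R⟩ ∈ G.predSyms false ∧ RelMap R (snd ∘ xs))

end Amalgam

/-- The signature consisting of the symbols of `F`, where `F` is at a position of polarity `s`. -/
def Formula.signature (F : L.Formula α) (s : Bool) : Signature L where
  rel s' := F.predSyms (s == s')
  func := F.funSyms
  eq s' := F.EqOccurs (s == s')

theorem Formula.over_signature (F : L.Formula α) (s : Bool) :
    BoundedFormula.Over (F.signature s) F.freeVars F s := by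
  rw [BoundedFormula.over_iff]
  refine ⟨fun s' => ?_, fun s' => ?_, subset_rfl, fun _ h => h⟩ <;>
    cases s <;> cases s' <;> simp [Formula.signature]

open Amalgam in
/-- A pair of structures in which all formulas of the interpolant signature are preserved can be
amalgamated into a model of `F` and `¬ G`. -/
theorem IsPair.exists_model {A B : Interp L α} {a : SkTerm L α → A.carrier}
    {b : SkTerm L α → B.carrier} (hp : IsPair F G Set.univ
      {φ | BoundedFormula.Over (interpolantSignature F G) Set.univ φ true} A B a b) :
    ∃ C : Interp L α, F.Realize C.val ∧ ¬ G.Realize C.val := by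
  let _ := inducedStructure F G a b
  have hrel {k : ℕ} (R : L.Relations k) (xs : Fin k → Carrier a b) :
      RelMap R xs ↔ (⟨_, R⟩ ∈ F.predSyms true ∧ RelMap R (fst ∘ xs)) ∨
        (⟨_, R⟩ ∈ G.predSyms false ∧ RelMap R (snd ∘ xs)) := Iff.rfl
  have hfst {k : ℕ} (xs : Fin k → Carrier a b) : (fun i => a (name (xs i))) = fst ∘ xs :=
    funext fun i => left_name _
  have hsnd {k : ℕ} (xs : Fin k → Carrier a b) : (fun i => b (name (xs i))) = snd ∘ xs :=
    funext fun i => right_name _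
  have hover (k : ℕ) (xs : Fin k → Carrier a b) (i : Fin k) :
      (Term.var (Sum.inl (name (xs i))) : L.Term (_ ⊕ Fin 0)).Over
        (interpolantSignature F G).func (scope Set.univ 0) := by
    simp [Term.Over]
  -- Atoms and negated atoms of the interpolant signature are preserved.
  have hrel_pos {k : ℕ} (R : L.Relations k) (hR : ⟨_, R⟩ ∈ F.predSyms true ∩ G.predSyms true)
      (xs : Fin k → Carrier a b) (h : RelMap R (fst ∘ xs)) : RelMap R (snd ∘ xs) := by
    rw [← hfst] at h
    rw [← hsnd]
    exact hp.preserves (.rel R fun i => .var (.inl (name (xs i)))) ⟨hR, hover k xs⟩ h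
  have hrel_neg {k : ℕ} (R : L.Relations k) (hR : ⟨_, R⟩ ∈ F.predSyms false ∩ G.predSyms false)
      (xs : Fin k → Carrier a b) (h : RelMap R (snd ∘ xs)) : RelMap R (fst ∘ xs) := by
    rw [← hsnd] at h
    rw [← hfst]
    by_contra h'
    exact hp.preserves (.imp (.rel R fun i => .var (.inl (name (xs i)))) .falsum)
      ⟨⟨hR, hover k xs⟩, trivial⟩ h' h
  have heq_pos (hF : F.EqOccurs true) : Function.Injective (fst : Carrier a b → _) := by
    refine fun x y h => ext h ?_
    rw [← left_name, ← left_name] at h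
    rw [← right_name, ← right_name]
    exact hp.preserves (.equal (.var (.inl (name x))) (.var (.inl (name y))))
      ⟨hF, hover 1 (fun _ => x) 0, hover 1 (fun _ => y) 0⟩ h
  have heq_neg (hG : G.EqOccurs false) : Function.Injective (snd : Carrier a b → _) := by
    refine fun x y h => ext ?_ h
    rw [← right_name, ← right_name] at h
    rw [← left_name, ← left_name]
    by_contra h'
    exact hp.preserves (.imp (.equal (.var (.inl (name x))) (.var (.inl (name y)))) .falsum)
      ⟨⟨hG, hover 1 (fun _ => x) 0, hover 1 (fun _ => y) 0⟩, trivial⟩ h' h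
  have hF := (BoundedFormula.realize_transfer (K := Carrier a b) (e := fst)
    (σ := F.signature true) (V := F.freeVars) (v := fun x => ofTerm (.var x)) (w := A.val)
    (fun f hf xs => hfst xs ▸ hp.respects_left (.func f fun i => name (xs i)) trivial hf)
    (fun x hx => hp.respects_left (.var x) trivial hx)
    (fun R hR xs h => Or.inl ⟨hR, h⟩)
    (fun R hR xs h => ((hrel R xs).1 h).elim (fun h => h.2) fun h => hrel_neg R ⟨hR, h.1⟩ xs h.2)
    heq_pos
    (fun φ xs => ⟨ofTerm (.sk true φ fun i => name (xs i)),
      hfst xs ▸ hp.respects_left (.sk true φ fun i => name (xs i)) trivial rfl⟩)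
    F default).1 (F.over_signature true)
  have hG := (BoundedFormula.realize_transfer (K := Carrier a b) (e := snd)
    (σ := G.signature false) (V := G.freeVars) (v := fun x => ofTerm (.var x)) (w := B.val)
    (fun f hf xs => hsnd xs ▸ hp.respects_right (.func f fun i => name (xs i)) trivial hf)
    (fun x hx => hp.respects_right (.var x) trivial hx)
    (fun R hR xs h => Or.inr ⟨hR, h⟩)
    (fun R hR xs h => ((hrel R xs).1 h).elim (fun h => hrel_pos R ⟨h.1, hR⟩ xs h.2) fun h => h.2)
    heq_neg
    (fun φ xs => ⟨ofTerm (.sk false φ fun i => name (xs i)),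
      hsnd xs ▸ hp.respects_right (.sk false φ fun i => name (xs i)) trivial rfl⟩)
    G default).2 (G.over_signature false)
  have : Nonempty (Carrier a b) := ⟨ofTerm (.sk true (.falsum : L.BoundedFormula α 1) Fin.elim0)⟩
  have hdef {M : Type (max u v w)} (e : Carrier a b → M) : e ∘ (default : Fin 0 → _) = default :=
    Subsingleton.elim _ _
  refine ⟨⟨Carrier a b, fun x => ofTerm (.var x)⟩, hF ?_, fun h => hp.right ?_⟩
  · rw [hdef]
    exact hp.left
  · have := hG h
    rwa [hdef] at this

end FirstOrder.Language

theorem mainTheorem2 {L : FirstOrder.Language.{u, v}} {α : Type w}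
    (F G : L.Formula α) (hFG : F ⟹[(∅ : L.Theory)] G) :
    ∃ H : L.Formula α,
      (F ⟹[(∅ : L.Theory)] H) ∧ (H ⟹[(∅ : L.Theory)] G) ∧
      H.voc ⊆ F.voc ∩ G.voc ∧
      (FirstOrder.Language.BoundedFormula.EqOccurs H true →
        FirstOrder.Language.BoundedFormula.EqOccurs F true) ∧
      (FirstOrder.Language.BoundedFormula.EqOccurs H false →
        FirstOrder.Language.BoundedFormula.EqOccurs G false) := by
  open FirstOrder.Language in
  obtain ⟨H, hover, hFH, hHG⟩ : ∃ H, IsInterpolant F G H := by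
    by_contra! h
    obtain ⟨A, B, a, b, hp⟩ := exists_isPair h
    obtain ⟨C, hF, hG⟩ := hp.exists_model
    exact hG (hFG (Theory.ModelType.of ∅ C.carrier) C.val default hF)
  obtain ⟨hpred, heq, hfunc, hvar⟩ := (FirstOrder.Language.BoundedFormula.over_iff _ _).1 hover
  refine ⟨H, fun M x xs h => ?_, fun M x xs h => ?_, ?_, heq true, heq false⟩
  · rw [Subsingleton.elim xs default] at h ⊢
    exact hFH ⟨M, x⟩ h
  · rw [Subsingleton.elim xs default] at h ⊢
    exact hHG ⟨M, x⟩ h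
  · rintro (⟨s, R⟩ | f | x) h
    · cases s
      exacts [hpred false h, hpred true h]
    · exact hfunc h
    · exact hvar x h
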